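/- **Theorem.** Let $\mathbb K=\mathbb R$ or $\mathbb C$, let $m\ge 1$ and $n\ge 0$ be integers, let $\mathcal S_n=\mathcal S(\mathbb R^n,\mathbb K)$ be the Schwartz space and $\mathcal S_n'$ its dual, the space of tempered distributions. Denote by $\beta(\mathcal S_n')$ the strong topology of $\mathcal S_n'$ (uniform convergence on bounded subsets of $\mathcal S_n$) and by $\sigma(\mathcal S_n')$ its weak-$*$ topology (pointwise convergence on $\mathcal S_n$). A family $v=(v_p)_{p\in\mathbb R^m}$ in $\mathcal S_n'$ is called an *$\mathcal S$-family* if for every $\varphi\in\mathcal S_n$ the function $v(\varphi):\mathbb R^m\to\mathbb K$, $p\mapsto v_p(\varphi)$, belongs to $\mathcal S_m$. For a vector topology $\tau$ on $\mathcal S_n'$, the family $v$ is called *$\tau$-topologically free* if there is a family $(L_i)_{i\in\mathbb R^m}$ of $\tau$-continuous linear forms on $\mathcal S_n'$ with $L_i(v_k)=\delta_{ik}$ (Kronecker delta) for all $i,k\in\mathbb R^m$, and *$\tau$-topologically bound* otherwise. Then every $\mathcal S$-family $v=(v_p)_{p\in\mathbb R^m}$ in $\mathcal S_n'$ is $\beta(\mathcal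 S_n')$-topologically bound, and it is also $\sigma(\mathcal S_n')$-topologically bound. Moreover, $v$ has no dual family of test functions: there is no family $(g_i)_{i\in\mathbb R^m}$ in $\mathcal S_n$ with $v_k(g_i)=\delta_{ik}$ for all $i,k\in\mathbb R^m$. -/

import Mathlib

open scoped SchwartzMap

/-- `IsSFamily v`: the family `v = (v_p)`, indexed by `p` in the Euclidean space `ℝ^m`, of tempered
distributions on `ℝ^n` is an S-family (a family of class S), that is, for every test function `φ`
in `𝓢(ℝ^n, 𝕜)` the function `v(φ) : p ↦ v_p(φ)` is a Schwartz function on `ℝ^m`. -/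
def IsSFamily {𝕜 : Type*} [RCLike 𝕜] {m n : ℕ}
    (v : EuclideanSpace ℝ (Fin m) → StrongDual 𝕜 𝓢(EuclideanSpace ℝ (Fin n), 𝕜)) : Prop :=
  ∀ φ : 𝓢(EuclideanSpace ℝ (Fin n), 𝕜), ∃ ψ : 𝓢(EuclideanSpace ℝ (Fin m), 𝕜), ∀ p, ψ p = v p φ

open Classical in
/-- A family `v` of vectors of a topological vector space `V` is topologically free (for the
topology of `V`) if there is a family `L` of continuous linear forms on `V`, with the same index
set, such that `L_i(v_k) = δ_{ik}` for all `i`, `k`. -/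
def IsTopologicallyFree (𝕜 : Type*) {V ι : Type*} [RCLike 𝕜] [AddCommGroup V] [Module 𝕜 V]
    [TopologicalSpace V] (v : ι → V) : Prop :=
  ∃ L : ι → (V →L[𝕜] 𝕜), ∀ i k, L i (v k) = if i = k then 1 else 0

/-- A family of vectors is topologically bound if it is not topologically free. -/
def IsTopologicallyBound (𝕜 : Type*) {V ι : Type*} [RCLike 𝕜] [AddCommGroup V] [Module 𝕜 V]
    [TopologicalSpace V] (v : ι → V) : Prop :=
  ¬ IsTopologicallyFree 𝕜 v

open Classical in
/-- `g` is a dual family of test functions of the family of tempered distributions `v`: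
`⟨g_i, v_k⟩ = v_k(g_i) = δ_{ik}` for all indices `i`, `k`. -/
def IsDualFamilyOfTestFunctions {𝕜 ι : Type*} [RCLike 𝕜] {n : ℕ}
    (g : ι → 𝓢(EuclideanSpace ℝ (Fin n), 𝕜))
    (v : ι → StrongDual 𝕜 𝓢(EuclideanSpace ℝ (Fin n), 𝕜)) : Prop :=
  ∀ i k, v k (g i) = if i = k then 1 else 0

/-!
A family `v` indexed by `ℝ^m`, `m ≥ 1`, that is continuous for a vector topology `τ` is
`τ`-topologically bound: for a continuous linear form `L` with `L (v k) = δ_{ik}`, the function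
`k ↦ L (v k)` would be continuous, equal to `1` at `i` and to `0` elsewhere, although `i` is not
isolated. The same argument, with evaluation at `g i` in place of `L`, excludes a dual family of
test functions. It therefore suffices to show that an S-family is continuous for `σ` and for `β`.

Continuity for `σ` is the continuity of the functions `p ↦ v p φ`. For `β` it has to be made uniform
for `φ` in a bounded set `B`. Each `p ↦ v p φ` is a Schwartz function, hence Lipschitz, so the
difference quotients `(v p - v q) / ‖p - q‖` form a pointwise bounded family of continuous linear
forms. A uniform boundedness principle (`SchwartzMap.exists_forall_mem_norm_le_of_pointwise_bounded`)
bounds them uniformly on `B`, which gives `‖v p φ - v q φ‖ ≤ C * ‖p - q‖` for all `φ ∈ B`. The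
principle is reduced to the Banach–Steinhaus theorem on the Banach space `ℓ¹(B)`, through the
continuous linear map `ℓ¹(B) → 𝓢(E, F)`, `c ↦ ∑ b, c b • b`
(`SchwartzMap.exists_clm_lp_one_apply_single`).
-/

open Filter Bornology
open scoped Topology

/-! ### Uniform boundedness on bounded sets of Schwartz functions -/

namespace SchwartzMap

variable {𝕜 E F : Type*} [RCLike 𝕜] [NormedAddCommGroup E] [NormedSpace ℝ E]
  [NormedAddCommGroup F] [NormedSpace ℝ F] [NormedSpace 𝕜 F] [SMulCommClass ℝ 𝕜 F]

theorem exists_forall_seminorm_le_of_isVonNBounded {B : Set 𝓢(E, F)} (hB : IsVonNBounded 𝕜 B)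
    (k n : ℕ) : ∃ M, 0 ≤ M ∧ ∀ b ∈ B, SchwartzMap.seminorm 𝕜 k n b ≤ M := by
  obtain ⟨M, hM, h⟩ :=
    (schwartz_withSeminorms 𝕜 E F).isVonNBounded_iff_seminorm_bounded.1 hB (k, n)
  exact ⟨M, hM.le, fun b hb => (h b hb).le⟩

/-- A series of Schwartz functions that converges absolutely in every Schwartz seminorm has a
Schwartz function as its pointwise sum, and its seminorms are bounded termwise. -/
theorem exists_eq_tsum [CompleteSpace F] {ι : Type*} (f : ι → 𝓢(E, F))
    (hf : ∀ k n : ℕ, Summable fun i => SchwartzMap.seminorm 𝕜 k n (f i)) :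
    ∃ g : 𝓢(E, F), (∀ x, g x = ∑' i, f i x) ∧
      ∀ k n : ℕ, SchwartzMap.seminorm 𝕜 k n g ≤ ∑' i, SchwartzMap.seminorm 𝕜 k n (f i) := by
  have hsmooth : ∀ i, ContDiff ℝ ((⊤ : ℕ∞) : WithTop ℕ∞) (f i) := fun i => (f i).smooth ⊤
  have hbound : ∀ (n : ℕ) (i : ι) (x : E), (n : ℕ∞) ≤ (⊤ : ℕ∞) →
      ‖iteratedFDeriv ℝ n (f i) x‖ ≤ SchwartzMap.seminorm 𝕜 0 n (f i) :=
    fun n i x _ => norm_iteratedFDeriv_le_seminorm 𝕜 (f i) n x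
  have hdecay : ∀ (k n : ℕ) (x : E),
      ‖x‖ ^ k * ‖iteratedFDeriv ℝ n (fun y => ∑' i, f i y) x‖ ≤
        ∑' i, SchwartzMap.seminorm 𝕜 k n (f i) := by
    intro k n x
    rw [iteratedFDeriv_tsum_apply hsmooth (fun n _ => hf 0 n) hbound le_top x]
    have hs : Summable fun i => ‖iteratedFDeriv ℝ n (f i) x‖ :=
      (hf 0 n).of_nonneg_of_le (fun _ => norm_nonneg _) fun i => hbound n i x le_top
    calc ‖x‖ ^ k * ‖∑' i, iteratedFDeriv ℝ n (f i) x‖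
        ≤ ‖x‖ ^ k * ∑' i, ‖iteratedFDeriv ℝ n (f i) x‖ := by
          gcongr
          exact norm_tsum_le_tsum_norm hs
      _ = ∑' i, ‖x‖ ^ k * ‖iteratedFDeriv ℝ n (f i) x‖ := tsum_mul_left.symm
      _ ≤ ∑' i, SchwartzMap.seminorm 𝕜 k n (f i) :=
          (hs.mul_left _).tsum_le_tsum (fun i => le_seminorm 𝕜 k n (f i) x) (hf k n)
  refine ⟨⟨fun x => ∑' i, f i x, contDiff_tsum hsmooth (fun n _ => hf 0 n) hbound,
    fun k n => ⟨_, hdecay k n⟩⟩, fun x => rfl, fun k n => ?_⟩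
  exact seminorm_le_bound 𝕜 k n _ (tsum_nonneg fun i => apply_nonneg _ _) (hdecay k n)

open Classical in
/-- A bounded set `B` of Schwartz functions is contained in the image of the closed unit ball of the
Banach space `ℓ¹(B)` under the continuous linear map `c ↦ ∑ b, c b • b`. -/
theorem exists_clm_lp_one_apply_single [CompleteSpace F] {B : Set 𝓢(E, F)}
    (hB : IsVonNBounded 𝕜 B) :
    ∃ Φ : lp (fun _ : B => 𝕜) 1 →L[𝕜] 𝓢(E, F), ∀ b : B, Φ (lp.single 1 b (1 : 𝕜)) = b := by
  choose M hM0 hM using exists_forall_seminorm_le_of_isVonNBounded hB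
  have hnorm : ∀ c : lp (fun _ : B => 𝕜) 1, HasSum (fun b => ‖c b‖) ‖c‖ := fun c => by
    simpa using lp.hasSum_norm (p := 1) (by simp) c
  have hle : ∀ (c : lp (fun _ : B => 𝕜) 1) (k n : ℕ) (b : B),
      SchwartzMap.seminorm 𝕜 k n (c b • (b : 𝓢(E, F))) ≤ ‖c b‖ * M k n := fun c k n b => by
    rw [map_smul_eq_mul]
    exact mul_le_mul_of_nonneg_left (hM k n b b.2) (norm_nonneg _)
  have hsum : ∀ (c : lp (fun _ : B => 𝕜) 1) (k n : ℕ),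
      Summable fun b : B => SchwartzMap.seminorm 𝕜 k n (c b • (b : 𝓢(E, F))) := fun c k n =>
    ((hnorm c).summable.mul_right _).of_nonneg_of_le (fun _ => apply_nonneg _ _) (hle c k n)
  have hpt : ∀ (c : lp (fun _ : B => 𝕜) 1) (x : E),
      Summable fun b : B => c b • (b : 𝓢(E, F)) x := fun c x =>
    Summable.of_norm_bounded (hsum c 0 0) fun b =>
      norm_le_seminorm 𝕜 (c b • (b : 𝓢(E, F))) x
  choose g hg hgle using fun c : lp (fun _ : B => 𝕜) 1 =>
    exists_eq_tsum (𝕜 := 𝕜) (fun b : B => c b • (b : 𝓢(E, F))) (hsum c)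
  let Φ : lp (fun _ : B => 𝕜) 1 →ₗ[𝕜] 𝓢(E, F) :=
    { toFun := g
      map_add' := fun c d => by
        ext x
        simp only [hg, add_apply, smul_apply, lp.coeFn_add, Pi.add_apply, add_smul]
        exact (hpt c x).tsum_add (hpt d x)
      map_smul' := fun a c => by
        ext x
        simp only [hg, smul_apply, lp.coeFn_smul, Pi.smul_apply, smul_assoc, RingHom.id_apply]
        exact (hpt c x).tsum_const_smul a }
  have hΦ : Continuous Φ := by
    refine (schwartz_withSeminorms 𝕜 E F).continuous_normedSpace_dom _ Φ
      fun kn => ⟨⟨M kn.1 kn.2, hM0 _ _⟩, fun c => ?_⟩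
    calc SchwartzMap.seminorm 𝕜 kn.1 kn.2 (g c)
        ≤ ∑' b : B, SchwartzMap.seminorm 𝕜 kn.1 kn.2 (c b • (b : 𝓢(E, F))) := hgle c _ _
      _ ≤ ∑' b : B, ‖c b‖ * M kn.1 kn.2 :=
          (hsum c _ _).tsum_le_tsum (hle c _ _) ((hnorm c).summable.mul_right _)
      _ = M kn.1 kn.2 * ‖c‖ := by rw [tsum_mul_right, (hnorm c).tsum_eq, mul_comm]
  refine ⟨⟨Φ, hΦ⟩, fun b => ?_⟩
  ext x
  change g _ x = _
  rw [hg, tsum_eq_single b]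
  · simp
  · intro b' hb'
    simp [hb']

/-- **Uniform boundedness principle** on the Schwartz space: a pointwise bounded family of
continuous linear maps is uniformly bounded on each bounded set. -/
theorem exists_forall_mem_norm_le_of_pointwise_bounded [CompleteSpace F] {ι G : Type*}
    [NormedAddCommGroup G] [NormedSpace 𝕜 G] (T : ι → 𝓢(E, F) →L[𝕜] G)
    (hT : ∀ φ, ∃ C, ∀ i, ‖T i φ‖ ≤ C) {B : Set 𝓢(E, F)} (hB : IsVonNBounded 𝕜 B) :
    ∃ C, ∀ i, ∀ φ ∈ B, ‖T i φ‖ ≤ C := by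
  classical
  obtain ⟨Φ, hΦ⟩ := exists_clm_lp_one_apply_single hB
  obtain ⟨C, hC⟩ := banach_steinhaus (g := fun i => (T i).comp Φ) fun c => hT (Φ c)
  refine ⟨C, fun i φ hφ => ?_⟩
  have h := ((T i).comp Φ).le_of_opNorm_le (hC i) (lp.single 1 ⟨φ, hφ⟩ (1 : 𝕜))
  simpa [hΦ, lp.norm_single] using h

theorem norm_sub_le_seminorm_mul_norm_sub (f : 𝓢(E, F)) (x y : E) :
    ‖f x - f y‖ ≤ SchwartzMap.seminorm 𝕜 0 1 f * ‖x - y‖ := by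
  refine convex_univ.norm_image_sub_le_of_norm_fderiv_le (𝕜 := ℝ)
    (fun z _ => f.differentiableAt) (fun z _ => ?_) (Set.mem_univ y) (Set.mem_univ x)
  rw [← norm_iteratedFDeriv_one]
  exact norm_iteratedFDeriv_le_seminorm 𝕜 f 1 z

end SchwartzMap

/-! ### Continuity of S-families -/

section SFamily

variable {𝕜 : Type*} [RCLike 𝕜] {m n : ℕ}
  {v : EuclideanSpace ℝ (Fin m) → StrongDual 𝕜 𝓢(EuclideanSpace ℝ (Fin n), 𝕜)}

theorem IsSFamily.continuous_apply (hv : IsSFamily v) (φ : 𝓢(EuclideanSpace ℝ (Fin n), 𝕜)) :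
    Continuous fun p => v p φ := by
  obtain ⟨ψ, hψ⟩ := hv φ
  exact ψ.continuous.congr hψ

theorem IsSFamily.continuous_toWeakDual (hv : IsSFamily v) :
    Continuous fun p => StrongDual.toWeakDual (v p) :=
  WeakDual.continuous_of_continuous_eval hv.continuous_apply

/-- On a bounded set of test functions, an S-family satisfies a uniform Lipschitz condition at each
point. -/
theorem IsSFamily.exists_norm_sub_le (hv : IsSFamily v) (q : EuclideanSpace ℝ (Fin m))
    {B : Set 𝓢(EuclideanSpace ℝ (Fin n), 𝕜)} (hB : IsVonNBounded 𝕜 B) :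
    ∃ C, ∀ p, ∀ φ ∈ B, ‖v p φ - v q φ‖ ≤ C * ‖p - q‖ := by
  -- The difference quotient at `p = q` is `0`, since `0⁻¹ = 0`.
  obtain ⟨C, hC⟩ := SchwartzMap.exists_forall_mem_norm_le_of_pointwise_bounded
    (fun p => ((‖p - q‖⁻¹ : ℝ) : 𝕜) • (v p - v q)) (fun φ => by
      obtain ⟨ψ, hψ⟩ := hv φ
      refine ⟨SchwartzMap.seminorm 𝕜 0 1 ψ, fun p => ?_⟩
      have h := ψ.norm_sub_le_seminorm_mul_norm_sub (𝕜 := 𝕜) p q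
      rw [hψ, hψ] at h
      simpa [norm_smul, ← div_eq_inv_mul] using
        div_le_of_le_mul₀ (norm_nonneg _) (apply_nonneg _ _) h) hB
  refine ⟨C, fun p φ hφ => ?_⟩
  rcases eq_or_ne p q with rfl | hpq
  · simp
  · have h := hC p φ hφ
    have hpos : 0 < ‖p - q‖ := norm_pos_iff.2 (sub_ne_zero.2 hpq)
    rw [← div_le_iff₀ hpos]
    simpa [norm_smul, ← div_eq_inv_mul] using h

/-- An S-family is continuous for the strong topology of the space of tempered distributions. -/
theorem IsSFamily.continuous (hv : IsSFamily v) : Continuous v := by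
  refine continuous_iff_continuousAt.2 fun q => ?_
  refine (UniformConvergenceCLM.tendsto_iff_tendstoUniformlyOn (RingHom.id 𝕜) 𝕜
    {B | IsVonNBounded 𝕜 B}).2 fun B hB => ?_
  obtain ⟨C, hC⟩ := hv.exists_norm_sub_le q hB
  have hlim : Tendsto (fun p => C * ‖p - q‖) (𝓝 q) (𝓝 0) := by
    have h : Continuous fun p => C * ‖p - q‖ := by fun_prop
    simpa using h.tendsto q
  refine Metric.tendstoUniformlyOn_iff.2 fun ε hε => ?_
  filter_upwards [hlim.eventually_lt_const hε] with p hp φ hφ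
  rw [dist_comm, dist_eq_norm]
  exact (hC p φ hφ).trans_lt hp

end SFamily

/-! ### Continuous families are topologically bound -/

open Classical in
/-- The indicator function of a point that is not isolated is not continuous. -/
theorem not_continuous_ite_eq {X M : Type*} [TopologicalSpace X] [TopologicalSpace M] [T2Space M]
    [Zero M] [One M] [NeZero (1 : M)] (i : X) [(𝓝[≠] i).NeBot] :
    ¬ Continuous fun k => if i = k then (1 : M) else 0 := by
  intro h
  have h1 : Tendsto (fun k => if i = k then (1 : M) else 0) (𝓝[≠] i) (𝓝 1) := by
    simpa using (h.tendsto i).mono_left nhdsWithin_le_nhds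
  have h0 : Tendsto (fun k => if i = k then (1 : M) else 0) (𝓝[≠] i) (𝓝 0) :=
    tendsto_const_nhds.congr' <| by
      filter_upwards [self_mem_nhdsWithin] with k hk
      exact (if_neg (Ne.symm hk)).symm
  exact one_ne_zero (tendsto_nhds_unique h1 h0)

theorem isTopologicallyBound_of_continuous {𝕜 V X : Type*} [RCLike 𝕜] [AddCommGroup V] [Module 𝕜 V]
    [TopologicalSpace V] [TopologicalSpace X] (i : X) [(𝓝[≠] i).NeBot] {v : X → V}
    (hv : Continuous v) : IsTopologicallyBound 𝕜 v := by
  rintro ⟨L, hL⟩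
  refine not_continuous_ite_eq (M := 𝕜) i ?_
  exact ((L i).continuous.comp hv).congr (hL i)

/-- The type `StrongDual 𝕜 𝓢(ℝ^n, 𝕜)` carries the strong topology `β`, of uniform convergence on
bounded sets of test functions; `WeakDual 𝕜 𝓢(ℝ^n, 𝕜)` is the same vector space with the weak-star
topology `σ`, of pointwise convergence on test functions. -/
theorem mainTheorem2 {𝕜 : Type*} [RCLike 𝕜] {m n : ℕ} (hm : 0 < m)
    (v : EuclideanSpace ℝ (Fin m) → StrongDual 𝕜 𝓢(EuclideanSpace ℝ (Fin n), 𝕜))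
    (hv : IsSFamily v) :
    IsTopologicallyBound 𝕜 v ∧
    IsTopologicallyBound 𝕜 (fun p => StrongDual.toWeakDual (v p)) ∧
    ¬ ∃ g : EuclideanSpace ℝ (Fin m) → 𝓢(EuclideanSpace ℝ (Fin n), 𝕜),
        IsDualFamilyOfTestFunctions g v := by
  -- `ℝ^m` is nontrivial for `m ≥ 1`, so that `0` is not isolated in it.
  have : Nonempty (Fin m) := ⟨⟨0, hm⟩⟩
  have : (𝓝[≠] (0 : EuclideanSpace ℝ (Fin m))).NeBot := Module.punctured_nhds_neBot ℝ _ 0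
  refine ⟨isTopologicallyBound_of_continuous 0 hv.continuous,
    isTopologicallyBound_of_continuous 0 hv.continuous_toWeakDual, ?_⟩
  rintro ⟨g, hg⟩
  refine not_continuous_ite_eq (M := 𝕜) (0 : EuclideanSpace ℝ (Fin m)) ?_
  exact (hv.continuous_apply (g 0)).congr (hg 0)
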